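/- For $\mu\ge 0$ let $\mathrm{Po}(\mu)$ denote a Poisson random variable with mean $\mu$, and for integers $j\ge 2$ put $\omega_j=\mathbb P(\mathrm{Po}(j)<j-1)$. Then the following hold, all series converging absolutely. (i) $\displaystyle\sum_{j=2}^\infty \frac1j\Bigl(\frac12-\mathbb P(\mathrm{Po}(j)<j-1)\Bigr)=\frac12(1+\log 2).$ (ii) $\displaystyle\sum_{j=1}^\infty \frac1j\Bigl(\frac12-\mathbb P(\mathrm{Po}(j)<j)\Bigr)=\frac12\log 2.$ (iii) $\displaystyle\sum_{j=2}^\infty \frac1j\,\mathbb P(\mathrm{Po}(j)=j-1)=\mathbb P(B\ge 2)=1-\frac1e,$ where $B$ has the Borel distribution with parameter $1$, that is, $\mathbb P(B=j)=e^{-j}j^{j-1}/j!$ for $j\ge 1$. (iv) If $Z_j$ is Poisson with mean $1/(2j)$ for each $j\ge2$, then the infinite product below converges unconditionally and $\displaystyle e^{-1/2}\prod_{j=2}^\infty \mathbb E\bigl[(2\omega_j)^{Z_j}\bigr]=\frac{1}{e\sqrt2}.$ (v) For $n\ge1$ let $(C_1(n),\dots,C_n(n))$ follow the Ewens Sampling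 Formula with parameter $\theta=\tfrac12$, that is, $$\mathbb P(C_j(n)=a_j,\ 1\le j\le n)=\frac{n!}{\theta(\theta+1)\cdots(\theta+n-1)}\prod_{j=1}^n\Bigl(\frac{\theta}{j}\Bigr)^{a_j}\frac1{a_j!}$$ for non-negative integers $a_1,\dots,a_n$ with $\sum_{j=1}^n j a_j=n$. Then the acceptance rate $$\mathbb E\Bigl[\mathbf 1\{C_1(n)=0\}\prod_{j=2}^n(2\omega_j)^{C_j(n)}\Bigr]$$ of the rejection sampler that accepts $(C_1(n),\dots,C_n(n))$ with probability $\mathbf 1\{C_1(n)=0\}\prod_{j=2}^n(2\omega_j)^{C_j(n)}$ converges to $1/(e\sqrt2)$ as $n\to\infty$. -/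

import Mathlib

open scoped NNReal

noncomputable section

namespace ScreamingToes

/-- `omega j = P(Po(j) < j - 1)`, where `Po(j)` is Poisson with mean `j`
(used for `j ≥ 2` only, where the natural subtraction is the true one). -/
def omega (j : ℕ) : ℝ :=
  (ProbabilityTheory.poissonMeasure (j : ℝ≥0)).real (Set.Iio (j - 1))

/-- The Borel distribution with parameter `μ`: the measure on `ℕ` with mass
`exp (-μ j) (μ j) ^ (j - 1) / j!` at each `j ≥ 1` (and no mass at `0`). -/
def borelMeasure (μ : ℝ≥0) : MeasureTheory.Measure ℕ :=
  MeasureTheory.Measure.sum fun i : ℕ =>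
    ENNReal.ofReal (Real.exp (-(μ * ((i : ℝ) + 1))) * (μ * ((i : ℝ) + 1)) ^ i /
      (Nat.factorial (i + 1) : ℝ)) • MeasureTheory.Measure.dirac (i + 1)

/-- The Ewens Sampling Formula with parameter `θ`. The counts `(a_1, ..., a_n)` with
`∑ j a_j = n` are those of a partition `p` of `n`, with `a_j` the number of parts equal to `j`;
the probability of these counts is `n! / (θ (θ+1) ⋯ (θ+n-1)) ∏_j (θ/j)^{a_j} / a_j!`. -/
def ewens (θ : ℝ) (n : ℕ) (p : n.Partition) : ℝ :=
  (Nat.factorial n : ℝ) / (∏ i ∈ Finset.range n, (θ + i)) *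
    ∏ j ∈ Finset.Icc 1 n,
      (θ / (j : ℝ)) ^ (p.parts.count j) / (Nat.factorial (p.parts.count j) : ℝ)

/-- The acceptance weight `h(a_1, ..., a_n) = 1(a_1 = 0) ∏_{j=2}^n (ω_j / θ)^{a_j}`. -/
def acceptWeight (θ : ℝ) (n : ℕ) (p : n.Partition) : ℝ :=
  if p.parts.count 1 = 0 then
    ∏ j ∈ Finset.Icc 2 n, (omega j / θ) ^ (p.parts.count j)
  else 0

/-- The acceptance rate of the rejection sampler: the mean of the acceptance weight when
the counts follow the Ewens Sampling Formula, both with parameter `θ = 1/2`. -/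
def acceptanceRate (n : ℕ) : ℝ :=
  ∑ p : n.Partition, ewens (1 / 2) n p * acceptWeight (1 / 2) n p

end ScreamingToes

end

/-! ### Medians of Poisson laws: bounds on `1 / 2 - omega j`. -/

namespace ScreamingToes

open Finset Filter Topology MeasureTheory ProbabilityTheory

/-! The three series come from the tree function `T`, defined by `T(x e^{-x}) = x` on `(0, 1)`. Its
powers have explicit coefficients (`hasSum_treeCoeff`). At `s = x e^{1-x}`, `T` itself is the
generating function of the Borel masses `P(Po(j) = j - 1) / j`, and summing `T ^ m / m` shows that
`P(Po(j) < j) / j` generates `-log (1 - x)`. Subtracting this from `-(1/2) log (1 - s)` leaves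
`-(1/2) log ((1 - s) / (1 - x)^2)`, which tends to `(log 2) / 2` as `x → 1`. Since `P(Po(j) < j) ≤
1/2`, all coefficients are non-negative, so the limit passes to the series at `s = 1`
(`hasSum_of_tendsto_powerSeries`). The series with `omega` is the sum of the other two without their
terms at `j = 1`, and exponentiating it gives the infinite product.

For the acceptance rate, the exponential formula over partitions turns the expectation into the
ratio `[z^n] G / [z^n] (1 - z)^{-1/2}`, where `G = (1 - z)^{-1/2} H`, `H = exp (-∑ d_j z^j / j)`,
`d_1 = 1/2` and `d_j = 1/2 - omega j` for `j ≥ 2`. As `∑ d_j / j` converges with `d_j ≥ 0`, the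
coefficients of `H` are absolutely summable; as `d_j → 0`, they are `o(1/n)`. Under these two
conditions the ratio tends to `H(1)` (`tendsto_conv_invSqrtCoeff_div`), and `H(1) = exp (-1/2 - (1 +
log 2) / 2) = 1 / (e √2)`. -/

/-- The mass of the Poisson distribution with mean `t` at `k`. -/
noncomputable def poissonMass (t : ℝ) (k : ℕ) : ℝ := Real.exp (-t) * t ^ k / (k.factorial : ℝ)

/-- `P(Po(t) < n)`. -/
noncomputable def poissonCdf (n : ℕ) (t : ℝ) : ℝ := ∑ k ∈ range n, poissonMass t k

theorem poissonMass_nonneg {t : ℝ} (ht : 0 ≤ t) (k : ℕ) : 0 ≤ poissonMass t k := by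
  unfold poissonMass; positivity

theorem hasSum_poissonMass {t : ℝ} (ht : 0 ≤ t) : HasSum (poissonMass t) 1 :=
  hasSum_one_poissonMeasure ⟨t, ht⟩

theorem poissonMeasure_real_singleton_natCast (n k : ℕ) :
    (poissonMeasure (n : ℝ≥0)).real {k} = poissonMass n k := by
  rw [poissonMeasure_real_singleton]; simp [poissonMass]

theorem poissonMeasure_real_Iio (n k : ℕ) :
    (poissonMeasure (n : ℝ≥0)).real (Set.Iio k) = poissonCdf k n := by
  have : (Set.Iio k) = ((range k : Finset ℕ) : Set ℕ) := by ext; simp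
  rw [this, ← sum_measureReal_singleton]
  exact Finset.sum_congr rfl fun i _ => poissonMeasure_real_singleton_natCast n i

theorem poissonMass_succ_self (n : ℕ) :
    poissonMass (n + 1 : ℕ) (n + 1) = poissonMass (n + 1 : ℕ) n := by
  unfold poissonMass
  rw [Nat.factorial_succ, pow_succ]
  push_cast
  have : (n.factorial : ℝ) ≠ 0 := by positivity
  field_simp

theorem omega_succ (n : ℕ) :
    omega (n + 1) = poissonCdf (n + 1) (n + 1 : ℕ) - poissonMass (n + 1 : ℕ) n := by
  unfold omega
  rw [poissonMeasure_real_Iio]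
  simp [poissonCdf, sum_range_succ]

theorem integral_pow_poissonMeasure (r : ℝ≥0) (c : ℝ) :
    ∫ k : ℕ, c ^ k ∂(poissonMeasure r) = Real.exp (r * (c - 1)) := by
  rw [integral_poissonMeasure]
  have h : HasSum (fun n : ℕ => Real.exp (-r) * ((r * c) ^ n / (n.factorial : ℝ)))
      (Real.exp (-r) * Real.exp (r * c)) := by
    refine HasSum.mul_left _ ?_
    rw [Real.exp_eq_exp_ℝ]
    exact NormedSpace.expSeries_div_hasSum_exp (r * c : ℝ)
  rw [← Real.exp_add] at h
  rw [show (r : ℝ) * (c - 1) = -r + r * c by ring, ← h.tsum_eq]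
  refine tsum_congr fun n => ?_
  rw [smul_eq_mul, mul_pow]; ring

/-- Reflecting the Poisson mass of mean `n` about `n - 1/2` moves it upwards. -/
theorem poissonMass_reflect {n i : ℕ} (hi : i < n) :
    poissonMass n (n - 1 - i) ≤ poissonMass n (n + i) := by
  induction i with
  | zero =>
    obtain ⟨m, rfl⟩ : ∃ m, n = m + 1 := ⟨n - 1, by omega⟩
    simpa using (poissonMass_succ_self m).ge
  | succ i ih =>
    have ih := ih (by omega)
    obtain ⟨m, rfl⟩ : ∃ m, n = m + i + 2 := ⟨n - i - 2, by omega⟩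
    have e1 : m + i + 2 - 1 - (i + 1) = m := by omega
    have e2 : m + i + 2 - 1 - i = m + 1 := by omega
    rw [e1]
    rw [e2] at ih
    set t : ℝ := ((m + i + 2 : ℕ) : ℝ) with ht
    have htv : t = m + i + 2 := by rw [ht]; push_cast; ring
    have ht0 : 0 < t := by rw [htv]; positivity
    have a1 : poissonMass t m * t = poissonMass t (m + 1) * (m + 1) := by
      unfold poissonMass
      rw [Nat.factorial_succ, pow_succ]
      push_cast
      have : (m.factorial : ℝ) ≠ 0 := by positivity
      have : (m : ℝ) + 1 ≠ 0 := by positivity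
      field_simp
    have a2 : poissonMass t (m + i + 2 + i) * t =
        poissonMass t (m + i + 2 + (i + 1)) * (t + i + 1) := by
      unfold poissonMass
      rw [← add_assoc, Nat.factorial_succ, pow_succ, htv]
      push_cast
      have : ((m + i + 2 + i).factorial : ℝ) ≠ 0 := by positivity
      have : (m : ℝ) + i + 2 + i + 1 ≠ 0 := by positivity
      field_simp
    have p1 := poissonMass_nonneg ht0.le (m + i + 2 + (i + 1))
    -- With `m + 1 = t - (i + 1)`, one further step outwards compares `(t - (i + 1)) (t + (i + 1))`
    -- with `t ^ 2`.
    have key : poissonMass t m * (t * t) ≤ poissonMass t (m + i + 2 + (i + 1)) * (t * t) := by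
      calc poissonMass t m * (t * t) = poissonMass t (m + 1) * t * (m + 1) := by
            rw [← mul_assoc, a1]; ring
        _ ≤ poissonMass t (m + i + 2 + i) * t * (m + 1) := by gcongr
        _ = poissonMass t (m + i + 2 + (i + 1)) * ((t + i + 1) * (m + 1)) := by rw [a2]; ring
        _ ≤ _ := by
            apply mul_le_mul_of_nonneg_left _ p1
            rw [htv]; nlinarith [(Nat.cast_nonneg i : (0:ℝ) ≤ i), (Nat.cast_nonneg m : (0:ℝ) ≤ m)]
    exact le_of_mul_le_mul_right key (by positivity)

/-- By reflection the mass on `[0, n)` is at most the mass on `[n, 2n)`, and together they are at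
most 1. -/
theorem poissonCdf_self_le_half (n : ℕ) : poissonCdf n n ≤ 1 / 2 := by
  have h1 : poissonCdf n n ≤ ∑ i ∈ range n, poissonMass n (n + i) := by
    unfold poissonCdf
    rw [← sum_range_reflect]
    exact sum_le_sum fun i hi => poissonMass_reflect (mem_range.1 hi)
  have h2 : poissonCdf n n + ∑ i ∈ range n, poissonMass n (n + i) ≤ 1 := by
    unfold poissonCdf
    rw [← sum_range_add]
    exact sum_le_hasSum _ (fun k _ => poissonMass_nonneg (Nat.cast_nonneg n) k)
      (hasSum_poissonMass (Nat.cast_nonneg n))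
  linarith

/-- Differentiating in the mean makes the sum telescope to its top term. -/
theorem hasDerivAt_poissonCdf (n : ℕ) (t : ℝ) :
    HasDerivAt (poissonCdf (n + 1)) (-poissonMass t n) t := by
  induction n with
  | zero =>
    have : poissonCdf (0 + 1) = fun t => Real.exp (-t) := by
      ext t; simp [poissonCdf, poissonMass]
    rw [this]
    convert (hasDerivAt_neg t).exp using 1
    simp [poissonMass]
  | succ n ih =>
    have : poissonCdf (n + 1 + 1) = fun t => poissonCdf (n + 1) t + poissonMass t (n + 1) := by
      ext t; simp [poissonCdf, sum_range_succ]
    rw [this]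
    have h := ((hasDerivAt_neg t).exp.mul (hasDerivAt_pow (n + 1) t)).div_const
      ((n + 1).factorial : ℝ)
    refine (ih.add h).congr_deriv ?_
    unfold poissonMass
    rw [Nat.factorial_succ, pow_succ]
    push_cast
    have : (n.factorial : ℝ) ≠ 0 := by positivity
    have : (n : ℝ) + 1 ≠ 0 := by positivity
    field_simp
    ring

theorem one_sub_mul_exp_le {v : ℝ} (hv : 0 ≤ v) :
    (1 - v) * Real.exp v ≤ (1 + v) * Real.exp (-v) := by
  let f : ℝ → ℝ := fun v => (1 + v) * Real.exp (-v) - (1 - v) * Real.exp v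
  have hd : ∀ x, HasDerivAt f (x * (Real.exp x - Real.exp (-x))) x := by
    intro x
    have h1 := ((hasDerivAt_id x).const_add 1).mul (hasDerivAt_neg x).exp
    have h2 := ((hasDerivAt_id x).const_sub 1).mul (Real.hasDerivAt_exp x)
    refine (h1.sub h2).congr_deriv ?_
    simp only [id]
    ring
  have hm : MonotoneOn f (Set.Ici 0) := by
    apply monotoneOn_of_deriv_nonneg (convex_Ici 0)
      (fun x _ => (hd x).continuousAt.continuousWithinAt)
      (fun x _ => (hd x).differentiableAt.differentiableWithinAt)
    intro x hx
    rw [interior_Ici, Set.mem_Ioi] at hx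
    rw [(hd x).deriv]
    exact mul_nonneg hx.le (sub_nonneg.2 (Real.exp_le_exp.2 (by linarith)))
  have := hm (Set.mem_Ici.2 le_rfl) (Set.mem_Ici.2 hv) hv
  simp only [f] at this
  norm_num at this
  linarith

theorem poissonMass_sub_le_add {n : ℕ} {u : ℝ} (hu : 0 ≤ u) (hun : u ≤ n) :
    poissonMass (n - u) n ≤ poissonMass (n + u) n := by
  rcases Nat.eq_zero_or_pos n with rfl | hn
  · have : u = 0 := le_antisymm (by simpa using hun) hu
    simp [this]
  have hn' : (0 : ℝ) < n := by exact_mod_cast hn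
  unfold poissonMass
  apply div_le_div_of_nonneg_right _ (by positivity)
  have hv : u / n ≤ 1 := (div_le_one hn').2 hun
  have key := one_sub_mul_exp_le (div_nonneg hu hn'.le)
  have k2 := pow_le_pow_left₀ (mul_nonneg (sub_nonneg.2 hv) (Real.exp_pos _).le) key n
  rw [mul_pow, mul_pow, ← Real.exp_nat_mul, ← Real.exp_nat_mul] at k2
  have e1 : (n : ℝ) * (u / n) = u := by field_simp
  have e2 : (n : ℝ) * (-(u / n)) = -u := by field_simp
  rw [e1, e2] at k2
  have f1 : (n : ℝ) - u = n * (1 - u / n) := by field_simp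
  have f2 : (n : ℝ) + u = n * (1 + u / n) := by field_simp
  have g1 : Real.exp (-((n : ℝ) - u)) = Real.exp (-n) * Real.exp u := by
    rw [← Real.exp_add]; ring_nf
  have g2 : Real.exp (-((n : ℝ) + u)) = Real.exp (-n) * Real.exp (-u) := by
    rw [← Real.exp_add]; ring_nf
  rw [g1, g2, f1, f2, mul_pow, mul_pow]
  have : 0 ≤ Real.exp (-n) * (n : ℝ) ^ n := by positivity
  nlinarith [mul_le_mul_of_nonneg_left k2 this]

/-- The mean is moved symmetrically about `n`: `f u = P(Po(n+u) ≤ n) + P(Po(n-u) ≤ n)` decreases on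
`[0, n]` by `poissonMass_sub_le_add`. It starts at twice the wanted probability and ends at least at
`P(Po(0) ≤ n) = 1`. -/
theorem half_le_poissonCdf_succ_self (n : ℕ) : 1 / 2 ≤ poissonCdf (n + 1) n := by
  let f : ℝ → ℝ := fun u => poissonCdf (n + 1) (n + u) + poissonCdf (n + 1) (n - u)
  have hd : ∀ u, HasDerivAt f (-poissonMass (n + u) n + poissonMass (n - u) n) u := by
    intro u
    have h1 := (hasDerivAt_poissonCdf n (n + u)).comp u ((hasDerivAt_id u).const_add (n : ℝ))
    have h2 := (hasDerivAt_poissonCdf n (n - u)).comp u ((hasDerivAt_id u).const_sub (n : ℝ))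
    refine (h1.add h2).congr_deriv ?_
    ring
  have hm : AntitoneOn f (Set.Icc 0 n) := by
    apply antitoneOn_of_deriv_nonpos (convex_Icc _ _)
      (fun x _ => (hd x).continuousAt.continuousWithinAt)
      (fun x _ => (hd x).differentiableAt.differentiableWithinAt)
    intro x hx
    rw [interior_Icc, Set.mem_Ioo] at hx
    rw [(hd x).deriv]
    linarith [poissonMass_sub_le_add hx.1.le hx.2.le]
  have h := hm (Set.left_mem_Icc.2 (Nat.cast_nonneg n)) (Set.right_mem_Icc.2 (Nat.cast_nonneg n))
    (Nat.cast_nonneg n)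
  simp only [f, add_zero, sub_zero, sub_self] at h
  have h0 : poissonCdf (n + 1) 0 = 1 := by
    simp [poissonCdf, sum_range_succ', poissonMass]
  have h1 : 0 ≤ poissonCdf (n + 1) (n + n) :=
    sum_nonneg fun k _ => poissonMass_nonneg (by positivity) k
  linarith

theorem omega_succ_le_half (n : ℕ) : omega (n + 1) ≤ 1 / 2 := by
  rw [omega_succ]
  linarith [poissonCdf_self_le_half (n + 1), poissonMass_nonneg (Nat.cast_nonneg (n + 1)) n]

/-- Passing from `P(Po(j) ≤ j) ≥ 1/2` to `omega j` drops the masses at `j - 1` and `j`, which are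
equal. -/
theorem half_sub_omega_succ_le (n : ℕ) :
    1 / 2 - omega (n + 1) ≤ 2 * poissonMass (n + 1 : ℕ) (n + 1) := by
  have h := half_le_poissonCdf_succ_self (n + 1)
  rw [poissonCdf, sum_range_succ, ← poissonCdf] at h
  rw [omega_succ, ← poissonMass_succ_self]
  linarith

theorem tendsto_poissonMass_self : Tendsto (fun n : ℕ => poissonMass n n) atTop (𝓝 0) := by
  have hlim : Tendsto (fun n : ℕ => (√(2 * Real.pi * n))⁻¹) atTop (𝓝 0) := by
    apply Tendsto.inv_tendsto_atTop
    apply Real.tendsto_sqrt_atTop.comp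
    exact tendsto_natCast_atTop_atTop.const_mul_atTop (by positivity)
  refine squeeze_zero' (Eventually.of_forall fun n => poissonMass_nonneg (Nat.cast_nonneg n) n)
    ?_ hlim
  filter_upwards [eventually_gt_atTop 0] with n hn
  have hn' : (0 : ℝ) < n := by exact_mod_cast hn
  have h := Stirling.le_factorial_stirling n
  have e : Real.exp (-n) * (n : ℝ) ^ n = (n / Real.exp 1) ^ n := by
    rw [div_pow, ← Real.exp_nat_mul, mul_one, Real.exp_neg]; ring
  unfold poissonMass
  rw [e, inv_eq_one_div, div_le_div_iff₀ (by positivity) (by positivity)]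
  linarith

theorem tendsto_half_sub_omega : Tendsto (fun n : ℕ => 1 / 2 - omega n) atTop (𝓝 0) := by
  rw [← tendsto_add_atTop_iff_nat 1]
  have h := ((tendsto_add_atTop_iff_nat 1).2 tendsto_poissonMass_self).const_mul 2
  rw [mul_zero] at h
  exact squeeze_zero (fun n => sub_nonneg.2 (omega_succ_le_half n)) half_sub_omega_succ_le h

end ScreamingToes

/-! ### Powers of the tree function and their expansions. -/

namespace ScreamingToes

open Finset Filter Topology

theorem hasSum_antidiagonal {F : ℕ × ℕ → ℝ} (hF : Summable F) {a : ℕ → ℝ} {s : ℝ}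
    (h : ∀ i, HasSum (fun l => F (i, l)) (a i)) (hs : HasSum a s) :
    HasSum (fun n => ∑ p ∈ antidiagonal n, F p) s := by
  have e : s = ∑' p, F p := hs.unique (hF.hasSum.prod_fiberwise h)
  have h2 := (Finset.HasAntidiagonal.sigmaAntidiagonalEquivProd.hasSum_iff (f := F)).2 (e ▸ hF.hasSum)
  refine h2.sigma fun n => ?_
  have h3 := hasSum_fintype (fun q : antidiagonal n => F q.1)
  rwa [Finset.sum_coe_sort (antidiagonal n) F] at h3

/-- The coefficient of `z ^ (k + i)` in the `k`-th power of the tree function. -/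
noncomputable def treeCoeff (k i : ℕ) : ℝ :=
  (k : ℝ) / (k + i : ℕ) * (((k + i : ℕ) : ℝ) ^ i / (i.factorial : ℝ))

theorem treeCoeff_nonneg (k i : ℕ) : 0 ≤ treeCoeff k i := by
  unfold treeCoeff; positivity

/-- From `y ^ i / i! ≤ exp y`; it gives convergence for `|z| < 1 / e`, which is all that `z = x
e^{-x}` with `0 < x < 1` needs. -/
theorem treeCoeff_le (k i : ℕ) : treeCoeff k i ≤ Real.exp k * Real.exp 1 ^ i := by
  have h1 : (k : ℝ) / (k + i : ℕ) ≤ 1 := by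
    apply div_le_one_of_le₀ _ (by positivity)
    push_cast
    linarith [(Nat.cast_nonneg i : (0 : ℝ) ≤ i)]
  have h2 := Real.pow_div_factorial_le_exp ((k + i : ℕ) : ℝ) (by positivity) i
  calc treeCoeff k i ≤ 1 * Real.exp ((k + i : ℕ) : ℝ) := by
        unfold treeCoeff; gcongr
    _ = _ := by rw [← Real.exp_nat_mul, ← Real.exp_add]; push_cast; ring_nf

/-- An `m`-th finite difference annihilates polynomials of degree `m - 1`. -/
theorem sum_choose_mul_pow_eq_zero {m : ℕ} (hm : 0 < m) (k : ℕ) :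
    ∑ i ∈ range (m + 1), (-1 : ℝ) ^ (m - i) * (m.choose i : ℝ) * ((k + i : ℕ) : ℝ) ^ (m - 1) = 0 := by
  have h1 := fwdDiff_iter_pow_eq_zero_of_lt (R := ℝ) (j := m - 1) (n := m) (by omega)
  have h2 := fwdDiff_iter_eq_sum_shift (1 : ℝ) (fun r : ℝ => r ^ (m - 1)) m (k : ℝ)
  rw [h1] at h2
  rw [Pi.zero_apply] at h2
  rw [h2]
  refine sum_congr rfl fun i _ => ?_
  simp

/-- This is the coefficient extraction behind `T(x e^{-x})^k e^{-kx} = x^k e^{-kx}` divided by `x^k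
e^{-kx}` and regrouped by powers of `x`: degree `m > 0` carries a multiple of an `m`-th difference
of a polynomial of degree `m - 1`. -/
theorem treeCoeff_antidiagonal {k m : ℕ} (hk : 0 < k) (x : ℝ) :
    ∑ p ∈ antidiagonal m, treeCoeff k p.1 * x ^ p.1 *
      ((-((k + p.1 : ℕ) : ℝ) * x) ^ p.2 / (p.2.factorial : ℝ)) = if m = 0 then 1 else 0 := by
  have hk' : (k : ℝ) ≠ 0 := by exact_mod_cast hk.ne'
  split_ifs with hm
  · subst hm; simp [treeCoeff, hk']
  have hm := Nat.pos_of_ne_zero hm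
  have h := sum_choose_mul_pow_eq_zero hm k
  rw [Nat.sum_antidiagonal_eq_sum_range_succ_mk]
  have h2 : ∀ i ∈ range (m + 1), treeCoeff k i * x ^ i *
      ((-((k + i : ℕ) : ℝ) * x) ^ (m - i) / ((m - i).factorial : ℝ)) =
      (k * x ^ m / (m.factorial : ℝ)) *
        ((-1 : ℝ) ^ (m - i) * (m.choose i : ℝ) * ((k + i : ℕ) : ℝ) ^ (m - 1)) := by
    intro i hi
    have hi : i ≤ m := by simpa [Nat.lt_succ_iff] using hi
    rw [Nat.cast_choose ℝ hi]
    unfold treeCoeff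
    have hn : ((k + i : ℕ) : ℝ) ≠ 0 := by positivity
    set t : ℝ := ((k + i : ℕ) : ℝ)
    have e1 : t ^ i * t ^ (m - i) = t * t ^ (m - 1) := by
      rw [← pow_add, ← pow_succ']; congr 1; omega
    have e2 : x ^ i * x ^ (m - i) = x ^ m := by rw [← pow_add]; congr 1; omega
    have : (i.factorial : ℝ) ≠ 0 := by positivity
    have : ((m - i).factorial : ℝ) ≠ 0 := by positivity
    have : (m.factorial : ℝ) ≠ 0 := by positivity
    rw [mul_pow, neg_pow, ← e2]
    field_simp
    linear_combination x ^ i * x ^ (m - i) * e1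
  rw [sum_congr rfl h2, ← mul_sum, h, mul_zero]

theorem summable_treeCoeff_mul_pow (k : ℕ) {z : ℝ} (hz : 0 ≤ z) (hz1 : Real.exp 1 * z < 1) :
    Summable fun i => treeCoeff k i * z ^ i := by
  refine Summable.of_nonneg_of_le (fun i => mul_nonneg (treeCoeff_nonneg k i) (by positivity))
    (fun i => ?_) ((summable_geometric_of_lt_one (by positivity) hz1).mul_left (Real.exp k))
  calc _ ≤ Real.exp k * Real.exp 1 ^ i * z ^ i := by gcongr; exact treeCoeff_le k i
    _ = _ := by rw [mul_pow]; ring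

/-- Each `e^{-(k+i)x}` is expanded and the double series is regrouped by total degree in `x`.
Absolute convergence replaces `e^{-x}` by `e^{x}`, hence needs `e x e^x < 1`; the bound `1/4`
suffices because `e^{5/4} < 4`. -/
theorem tsum_treeCoeff_of_small {k : ℕ} (hk : 0 < k) {x : ℝ} (hx : 0 < x) (hx4 : x < 1 / 4) :
    ∑' i, treeCoeff k i * (x * Real.exp (-x)) ^ i = Real.exp (k * x) := by
  let F : ℕ × ℕ → ℝ := fun p => treeCoeff k p.1 * x ^ p.1 *
      ((-((k + p.1 : ℕ) : ℝ) * x) ^ p.2 / (p.2.factorial : ℝ))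
  have hexp : ∀ y : ℝ, HasSum (fun l : ℕ => y ^ l / (l.factorial : ℝ)) (Real.exp y) := by
    intro y
    rw [Real.exp_eq_exp_ℝ]
    exact NormedSpace.expSeries_div_hasSum_exp y
  have hsmall : Real.exp 1 * (x * Real.exp x) < 1 := by
    have h1 : Real.exp x ≤ Real.exp (1 / 4) := Real.exp_le_exp.2 hx4.le
    have h2 : Real.exp 1 * Real.exp (1 / 4) < 4 := by
      rw [← Real.exp_add]
      have h3 : Real.exp (1 + 1 / 4) ^ 4 < 4 ^ 4 := by
        have e : Real.exp (1 + 1 / 4) ^ 4 = Real.exp 1 ^ 5 := by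
          rw [← Real.exp_nat_mul, ← Real.exp_nat_mul]; norm_num
        rw [e]
        calc Real.exp 1 ^ 5 < 3 ^ 5 := by
              gcongr; linarith [Real.exp_one_lt_d9]
          _ < 4 ^ 4 := by norm_num
      exact lt_of_pow_lt_pow_left₀ 4 (by norm_num) h3
    calc Real.exp 1 * (x * Real.exp x) = x * (Real.exp 1 * Real.exp x) := by ring
      _ ≤ x * (Real.exp 1 * Real.exp (1 / 4)) := by gcongr
      _ < x * 4 := by gcongr
      _ < 1 := by linarith
  have hF : Summable F := by
    apply Summable.of_norm
    rw [summable_prod_of_nonneg (fun p => norm_nonneg _)]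
    have e : ∀ i, HasSum (fun l => ‖F (i, l)‖)
        (treeCoeff k i * x ^ i * Real.exp ((k + i : ℕ) * x)) := by
      intro i
      convert! (hexp ((k + i : ℕ) * x)).mul_left (treeCoeff k i * x ^ i) using 2 with l
      have := treeCoeff_nonneg k i
      simp only [F, norm_mul, norm_div, norm_pow, Real.norm_eq_abs, abs_neg, Nat.abs_cast,
        abs_of_pos hx, abs_of_nonneg this]
    refine ⟨fun i => (e i).summable, ?_⟩
    have e' : (fun i => ∑' l, ‖F (i, l)‖) = fun i =>
        Real.exp (k * x) * (treeCoeff k i * (x * Real.exp x) ^ i) := by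
      ext i
      rw [(e i).tsum_eq, mul_pow, ← Real.exp_nat_mul]
      push_cast
      rw [add_mul, Real.exp_add]; ring
    rw [e']
    exact (summable_treeCoeff_mul_pow k (by positivity) hsmall).mul_left _
  have hz : Summable fun i => treeCoeff k i * (x * Real.exp (-x)) ^ i := by
    apply summable_treeCoeff_mul_pow k (by positivity)
    refine lt_of_le_of_lt ?_ hsmall
    gcongr; linarith
  have hrow : ∀ i, HasSum (fun l => F (i, l))
      (Real.exp (-(k * x)) * (treeCoeff k i * (x * Real.exp (-x)) ^ i)) := by
    intro i
    have h := (hexp (-((k + i : ℕ) : ℝ) * x)).mul_left (treeCoeff k i * x ^ i)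
    convert! h using 1
    rw [mul_pow, ← Real.exp_nat_mul]
    push_cast
    rw [show -((k : ℝ) + i) * x = -(k * x) + i * (-x) by ring, Real.exp_add]; ring
  have h1 := hasSum_antidiagonal hF hrow (hz.hasSum.mul_left _)
  have h2 : HasSum (fun m : ℕ => ∑ p ∈ antidiagonal m, F p) 1 := by
    simp only [F, treeCoeff_antidiagonal hk x]
    exact hasSum_ite_eq 0 1
  have h3 := h1.unique h2
  rw [Real.exp_neg, inv_mul_eq_one₀ (Real.exp_pos _).ne'] at h3
  exact h3.symm

theorem exp_one_mul_lt_one {x : ℝ} (hx1 : x < 1) : Real.exp 1 * (x * Real.exp (-x)) < 1 := by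
  have h := Real.add_one_lt_exp (x := x - 1) (by linarith)
  have : Real.exp 1 * (x * Real.exp (-x)) = x / Real.exp (x - 1) := by
    rw [Real.exp_sub, Real.exp_neg]; field_simp
  rw [this, div_lt_one (Real.exp_pos _)]
  linarith

theorem analyticOnNhd_tsum_treeCoeff (k : ℕ) :
    AnalyticOnNhd ℝ (fun z : ℝ => ∑' i, treeCoeff k i * z ^ i)
      (Metric.ball 0 (Real.exp (-1))) := by
  let p := FormalMultilinearSeries.ofScalars ℝ (treeCoeff k)
  let r : ℝ≥0 := ⟨Real.exp (-1), (Real.exp_pos _).le⟩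
  have hr : (r : ENNReal) ≤ p.radius := by
    apply p.le_radius_of_bound (Real.exp k)
    intro n
    rw [FormalMultilinearSeries.ofScalars_norm, Real.norm_of_nonneg (treeCoeff_nonneg k n)]
    calc treeCoeff k n * (Real.exp (-1)) ^ n
        ≤ Real.exp k * Real.exp 1 ^ n * Real.exp (-1) ^ n := by gcongr; exact treeCoeff_le k n
      _ = Real.exp k := by rw [mul_assoc, ← mul_pow, ← Real.exp_add]; simp
  have hr0 : 0 < r := Real.exp_pos _
  have hp := (p.hasFPowerSeriesOnBall (lt_of_lt_of_le (by exact_mod_cast hr0) hr)).analyticOnNhd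
  have e : p.sum = fun z : ℝ => ∑' i, treeCoeff k i * z ^ i := by
    have := FormalMultilinearSeries.ofScalarsSum_eq_tsum (E := ℝ) (treeCoeff k)
    simpa [FormalMultilinearSeries.ofScalarsSum, smul_eq_mul] using this
  rw [e] at hp
  refine hp.mono ?_
  intro z hz
  rw [Metric.mem_eball]
  refine lt_of_lt_of_le ?_ hr
  rw [edist_lt_coe]
  rw [Metric.mem_ball] at hz
  exact hz

/-- Both sides of the identity for small `x` are analytic on `(0, 1)`, where `x e^{-x} < 1 / e`, so
it extends there from a neighbourhood of `1/8`. -/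
theorem hasSum_treeCoeff {k : ℕ} (hk : 0 < k) {x : ℝ} (hx : 0 < x) (hx1 : x < 1) :
    HasSum (fun i => treeCoeff k i * (x * Real.exp (-x)) ^ (k + i)) (x ^ k) := by
  have han : AnalyticOnNhd ℝ (fun y : ℝ => ∑' i, treeCoeff k i * (y * Real.exp (-y)) ^ i)
      (Set.Ioo 0 1) := by
    refine (analyticOnNhd_tsum_treeCoeff k).comp (f := fun y : ℝ => y * Real.exp (-y)) ?_ ?_
    · intro y _
      exact analyticAt_id.mul analyticAt_id.neg.rexp'
    · intro y hy
      have h := exp_one_mul_lt_one hy.2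
      have h0 : 0 ≤ y * Real.exp (-y) := mul_nonneg hy.1.le (Real.exp_pos _).le
      rw [mem_ball_zero_iff, Real.norm_of_nonneg h0, Real.exp_neg 1, ← one_div,
        lt_div_iff₀' (Real.exp_pos _)]
      exact h
  have han2 : AnalyticOnNhd ℝ (fun y : ℝ => Real.exp (k * y)) (Set.Ioo 0 1) := fun y _ =>
    (analyticAt_const.mul analyticAt_id).rexp'
  have hev : (fun y : ℝ => ∑' i, treeCoeff k i * (y * Real.exp (-y)) ^ i) =ᶠ[𝓝 (1 / 8)]
      fun y : ℝ => Real.exp (k * y) := by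
    filter_upwards [Ioo_mem_nhds (a := (0 : ℝ)) (b := 1 / 4) (by norm_num) (by norm_num)] with y hy
    exact tsum_treeCoeff_of_small hk hy.1 hy.2
  have heq := han.eqOn_of_preconnected_of_eventuallyEq han2 isPreconnected_Ioo
    (z₀ := 1 / 8) (by norm_num) hev ⟨hx, hx1⟩
  have hs := (summable_treeCoeff_mul_pow k (mul_nonneg hx.le (Real.exp_pos (-x)).le)
    (exp_one_mul_lt_one hx1)).hasSum.mul_left ((x * Real.exp (-x)) ^ k)
  simp only at heq
  rw [heq, mul_pow, ← Real.exp_nat_mul, mul_assoc, ← Real.exp_add] at hs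
  rw [show (k : ℝ) * -x + k * x = 0 by ring, Real.exp_zero, mul_one] at hs
  refine hs.congr_fun ?_
  intro i
  rw [mul_pow x (Real.exp (-x)) (k + i), mul_pow, pow_add, pow_add, ← Real.exp_nat_mul _ k]; ring

theorem hasSum_tree {x : ℝ} (hx : 0 < x) (hx1 : x < 1) :
    HasSum (fun n : ℕ => poissonMass (n + 1 : ℕ) n / ((n + 1 : ℕ) : ℝ) *
      (x * Real.exp (1 - x)) ^ (n + 1)) x := by
  have h := hasSum_treeCoeff one_pos hx hx1
  rw [pow_one] at h
  refine h.congr_fun fun i => ?_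
  have e : Real.exp (1 - x) = Real.exp 1 * Real.exp (-x) := by rw [← Real.exp_add]; ring_nf
  rw [e, mul_left_comm, mul_pow, ← Real.exp_nat_mul, poissonMass, treeCoeff, Real.exp_neg,
    add_comm 1 i, mul_one]
  have : Real.exp ((i + 1 : ℕ) : ℝ) ≠ 0 := (Real.exp_pos _).ne'
  field_simp
  simp

/-- Expand `-log (1 - T) = ∑ T ^ m / m`. The factor `m` in the coefficients of `T ^ m` cancels `1 /
m`, so the coefficient of `z ^ j` is `1 / j` times the partial sum of `j ^ i / i!` over `i < j`. -/
theorem hasSum_poissonCdf_self {x : ℝ} (hx : 0 < x) (hx1 : x < 1) :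
    HasSum (fun n : ℕ => poissonCdf (n + 1) (n + 1 : ℕ) / ((n + 1 : ℕ) : ℝ) *
      (x * Real.exp (1 - x)) ^ (n + 1)) (-Real.log (1 - x)) := by
  have hlog := Real.hasSum_pow_div_log_of_abs_lt_one (x := x) (by rw [abs_of_pos hx]; exact hx1)
  let F : ℕ × ℕ → ℝ := fun p =>
    treeCoeff (p.1 + 1) p.2 * (x * Real.exp (-x)) ^ (p.1 + 1 + p.2) / ((p.1 : ℝ) + 1)
  have hrow : ∀ m, HasSum (fun i => F (m, i)) (x ^ (m + 1) / ((m : ℝ) + 1)) := fun m =>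
    (hasSum_treeCoeff (Nat.succ_pos m) hx hx1).div_const _
  have hF : Summable F := by
    rw [summable_prod_of_nonneg]
    · refine ⟨fun m => (hrow m).summable, ?_⟩
      simp only [fun m => (hrow m).tsum_eq]
      exact hlog.summable
    · intro p
      have := treeCoeff_nonneg (p.1 + 1) p.2
      simp only [F, Pi.zero_apply]
      positivity
  refine (hasSum_antidiagonal hF hrow hlog).congr_fun fun n => ?_
  rw [← Nat.sum_antidiagonal_swap, Nat.sum_antidiagonal_eq_sum_range_succ_mk]
  unfold poissonCdf
  rw [sum_div, sum_mul]
  refine sum_congr rfl fun i hi => ?_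
  have hi : i ≤ n := by simpa [Nat.lt_succ_iff] using hi
  have e : Real.exp (1 - x) = Real.exp 1 * Real.exp (-x) := by rw [← Real.exp_add]; ring_nf
  have e2 : n - i + 1 + i = n + 1 := by omega
  simp only [F, Prod.swap, treeCoeff, e2]
  rw [e, mul_left_comm, mul_pow (Real.exp 1), ← Real.exp_nat_mul, poissonMass, Real.exp_neg, mul_one]
  have : Real.exp ((n + 1 : ℕ) : ℝ) ≠ 0 := (Real.exp_pos _).ne'
  have : ((n - i : ℕ) : ℝ) + 1 ≠ 0 := by positivity
  push_cast
  field_simp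

end ScreamingToes

/-! ### Passage to the boundary: the three series and the product. -/

namespace ScreamingToes

open Finset Filter Topology MeasureTheory ProbabilityTheory

/-- A Tauberian theorem: a power series with non-negative coefficients which has a limit at `1`
converges at `1`, to the same limit. -/
theorem hasSum_of_tendsto_powerSeries {ι : Type*} {l : Filter ι} [l.NeBot] {a : ℕ → ℝ}
    (ha : ∀ n, 0 ≤ a n) {u F : ι → ℝ} {L : ℝ} (hu : Tendsto u l (𝓝[<] 1)) (hu0 : ∀ᶠ x in l, 0 ≤ u x)
    (hF : ∀ᶠ x in l, HasSum (fun n => a n * u x ^ (n + 1)) (F x)) (hL : Tendsto F l (𝓝 L)) :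
    HasSum a L := by
  have hu' : Tendsto u l (𝓝 1) := hu.mono_right nhdsWithin_le_nhds
  have hpart : ∀ N, ∑ n ∈ range N, a n ≤ L := by
    intro N
    have h1 : Tendsto (fun x => ∑ n ∈ range N, a n * u x ^ (n + 1)) l
        (𝓝 (∑ n ∈ range N, a n * 1 ^ (n + 1))) :=
      tendsto_finsetSum _ fun n _ => (hu'.pow (n + 1)).const_mul (a n)
    simp only [one_pow, mul_one] at h1
    -- Non-negativity bounds every partial sum by `F`, hence in the limit by `L`; Abel's theorem
    -- then identifies the sum.
    refine le_of_tendsto_of_tendsto h1 hL ?_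
    filter_upwards [hu0, hF] with x hx0 hx
    exact sum_le_hasSum _ (fun n _ => mul_nonneg (ha n) (pow_nonneg hx0 _)) hx
  have hs : Summable a := summable_of_sum_range_le ha hpart
  have h1 := (Real.tendsto_tsum_powerSeries_nhdsWithin_lt hs.hasSum.tendsto_sum_nat).comp hu
  have h2 := hu'.mul h1
  rw [one_mul] at h2
  have h3 : Tendsto F l (𝓝 (∑' n, a n)) := by
    refine h2.congr' ?_
    filter_upwards [hF] with x hx
    rw [← hx.tsum_eq, Function.comp, ← tsum_mul_left]
    exact tsum_congr fun n => by ring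
  rw [tendsto_nhds_unique hL h3]
  exact hs.hasSum

theorem mul_exp_one_sub_lt_one {x : ℝ} (hx1 : x < 1) : x * Real.exp (1 - x) < 1 := by
  have h := exp_one_mul_lt_one hx1
  have e : Real.exp (1 - x) = Real.exp 1 * Real.exp (-x) := by rw [← Real.exp_add]; ring_nf
  rw [e]; linarith

theorem eventually_mem_Ioo : ∀ᶠ x : ℝ in 𝓝[<] 1, x ∈ Set.Ioo (0 : ℝ) 1 :=
  Ioo_mem_nhdsLT one_pos

theorem tendsto_mul_exp_one_sub :
    Tendsto (fun x : ℝ => x * Real.exp (1 - x)) (𝓝[<] 1) (𝓝[<] 1) := by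
  apply tendsto_nhdsWithin_of_tendsto_nhds_of_eventually_within
  · have : Continuous fun x : ℝ => x * Real.exp (1 - x) := by fun_prop
    simpa using (this.tendsto 1).mono_left (nhdsWithin_le_nhds (s := Set.Iio 1))
  · filter_upwards [eventually_mem_Ioo] with x hx
    exact mul_exp_one_sub_lt_one hx.2

theorem hasSum_poissonMass_div :
    HasSum (fun n : ℕ => poissonMass (n + 1 : ℕ) n / ((n + 1 : ℕ) : ℝ)) 1 := by
  refine hasSum_of_tendsto_powerSeries
    (fun n => div_nonneg (poissonMass_nonneg (Nat.cast_nonneg _) _) (Nat.cast_nonneg _))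
    tendsto_mul_exp_one_sub ?_ ?_ (tendsto_id.mono_left nhdsWithin_le_nhds)
  · filter_upwards [eventually_mem_Ioo] with x hx
    exact mul_nonneg hx.1.le (Real.exp_pos _).le
  · filter_upwards [eventually_mem_Ioo] with x hx
    exact hasSum_tree hx.1 hx.2

/-- The map `x ↦ x e^{1-x}` has a quadratic maximum at 1; this constant `1/2` is the source of `log
2`. -/
theorem tendsto_one_sub_mul_exp_div :
    Tendsto (fun x : ℝ => (1 - x * Real.exp (1 - x)) / (1 - x) ^ 2) (𝓝[<] 1) (𝓝 (1 / 2)) := by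
  have hf : ∀ x : ℝ, HasDerivAt (fun x : ℝ => 1 - x * Real.exp (1 - x))
      (-((1 - x) * Real.exp (1 - x))) x := by
    intro x
    refine (((hasDerivAt_id x).mul ((hasDerivAt_id x).const_sub 1).exp).const_sub 1).congr_deriv ?_
    simp only [id]; ring
  have hg : ∀ x : ℝ, HasDerivAt (fun x : ℝ => (1 - x) ^ 2) (-(2 * (1 - x))) x := by
    intro x
    refine (((hasDerivAt_id x).const_sub 1).pow 2).congr_deriv ?_
    simp only [id]; ring
  have cf : Continuous fun x : ℝ => 1 - x * Real.exp (1 - x) := by fun_prop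
  have cg : Continuous fun x : ℝ => (1 - x) ^ 2 := by fun_prop
  refine HasDerivAt.lhopital_zero_nhdsLT (Eventually.of_forall hf) (Eventually.of_forall hg) ?_
    ?_ ?_ ?_
  · filter_upwards [eventually_mem_Ioo] with x hx
    have := hx.2
    exact neg_ne_zero.2 (mul_ne_zero two_ne_zero (by linarith))
  · simpa using (cf.tendsto 1).mono_left (nhdsWithin_le_nhds (s := Set.Iio 1))
  · simpa using (cg.tendsto 1).mono_left (nhdsWithin_le_nhds (s := Set.Iio 1))
  · have c : Continuous fun x : ℝ => Real.exp (1 - x) / 2 := by fun_prop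
    have h : Tendsto (fun x : ℝ => Real.exp (1 - x) / 2) (𝓝[<] 1) (𝓝 (1 / 2)) := by
      simpa using (c.tendsto 1).mono_left (nhdsWithin_le_nhds (s := Set.Iio 1))
    refine h.congr' ?_
    filter_upwards [eventually_mem_Ioo] with x hx
    have : 1 - x ≠ 0 := by have := hx.2; linarith
    field_simp

theorem hasSum_half_sub_poissonCdf :
    HasSum (fun n : ℕ => (1 / 2 - poissonCdf (n + 1) (n + 1 : ℕ)) / ((n + 1 : ℕ) : ℝ))
      (Real.log 2 / 2) := by
  refine hasSum_of_tendsto_powerSeries (u := fun x : ℝ => x * Real.exp (1 - x))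
    (F := fun x : ℝ => -(1 / 2) * Real.log ((1 - x * Real.exp (1 - x)) / (1 - x) ^ 2))
    (fun n => div_nonneg (sub_nonneg.2 (poissonCdf_self_le_half _)) (Nat.cast_nonneg _))
    tendsto_mul_exp_one_sub ?_ ?_ ?_
  · filter_upwards [eventually_mem_Ioo] with x hx
    exact mul_nonneg hx.1.le (Real.exp_pos _).le
  · filter_upwards [eventually_mem_Ioo] with x hx
    have hs0 : 0 ≤ x * Real.exp (1 - x) := mul_nonneg hx.1.le (Real.exp_pos _).le
    have hs1 := mul_exp_one_sub_lt_one hx.2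
    have h1 := (Real.hasSum_pow_div_log_of_abs_lt_one
      (x := x * Real.exp (1 - x)) (by rwa [abs_of_nonneg hs0])).mul_left (1 / 2)
    have h2 := h1.sub (hasSum_poissonCdf_self hx.1 hx.2)
    have hx2 : 1 - x ≠ 0 := by have := hx.2; linarith
    have e : -(1 / 2) * Real.log ((1 - x * Real.exp (1 - x)) / (1 - x) ^ 2) =
        1 / 2 * -Real.log (1 - x * Real.exp (1 - x)) - -Real.log (1 - x) := by
      rw [Real.log_div (by linarith) (pow_ne_zero 2 hx2), Real.log_pow]
      push_cast; ring
    rw [e]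
    refine h2.congr_fun fun n => ?_
    push_cast
    ring
  · have h := ((Real.continuousAt_log (x := 1 / 2) (by norm_num)).tendsto.comp
      tendsto_one_sub_mul_exp_div).const_mul (-(1 / 2))
    convert! h using 2
    rw [one_div, Real.log_inv]; ring

theorem hasSum_half_sub_poissonMeasure :
    HasSum (fun i : ℕ => 1 / ((i + 1 : ℕ) : ℝ) *
        (1 / 2 - (poissonMeasure ((i + 1 : ℕ) : ℝ≥0)).real (Set.Iio (i + 1))))
      (Real.log 2 / 2) := by
  refine hasSum_half_sub_poissonCdf.congr_fun fun n => ?_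
  rw [poissonMeasure_real_Iio]
  ring

theorem hasSum_poissonMeasure_singleton :
    HasSum (fun i : ℕ => 1 / ((i + 2 : ℕ) : ℝ) *
        (poissonMeasure ((i + 2 : ℕ) : ℝ≥0)).real {i + 1}) (1 - 1 / Real.exp 1) := by
  have h := (hasSum_nat_add_iff' 1).2 hasSum_poissonMass_div
  have e : 1 - ∑ i ∈ range 1, poissonMass (i + 1 : ℕ) i / ((i + 1 : ℕ) : ℝ) =
      1 - 1 / Real.exp 1 := by
    simp [poissonMass, Real.exp_neg]
  rw [e] at h
  refine h.congr_fun fun n => ?_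
  rw [poissonMeasure_real_singleton_natCast]
  ring

theorem hasSum_half_sub_omega :
    HasSum (fun i : ℕ => 1 / ((i + 2 : ℕ) : ℝ) * (1 / 2 - omega (i + 2)))
      ((1 + Real.log 2) / 2) := by
  have h := ((hasSum_nat_add_iff' 1).2 hasSum_half_sub_poissonCdf).add
    ((hasSum_nat_add_iff' 1).2 hasSum_poissonMass_div)
  have e : Real.log 2 / 2 - ∑ i ∈ range 1, (1 / 2 - poissonCdf (i + 1) (i + 1 : ℕ)) /
      ((i + 1 : ℕ) : ℝ) + (1 - ∑ i ∈ range 1, poissonMass (i + 1 : ℕ) i / ((i + 1 : ℕ) : ℝ)) =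
      (1 + Real.log 2) / 2 := by
    simp [poissonMass, poissonCdf]; ring
  rw [e] at h
  refine h.congr_fun fun n => ?_
  rw [omega_succ (n + 1)]
  ring

theorem borelMeasure_one_real_Ici_two :
    (borelMeasure 1).real (Set.Ici 2) = 1 - 1 / Real.exp 1 := by
  rw [Measure.real, borelMeasure, Measure.sum_apply _ (by measurability)]
  have h0 : ∀ i : ℕ, 0 ≤ 1 / ((i + 2 : ℕ) : ℝ) *
      (poissonMeasure ((i + 2 : ℕ) : ℝ≥0)).real {i + 1} := fun i => by positivity
  -- The term `i = 0` is the atom at 1, which lies outside `Set.Ici 2`.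
  rw [tsum_eq_zero_add' ENNReal.summable]
  rw [← hasSum_poissonMeasure_singleton.tsum_eq]
  rw [← ENNReal.toReal_ofReal (tsum_nonneg h0),
    ENNReal.ofReal_tsum_of_nonneg h0 hasSum_poissonMeasure_singleton.summable]
  congr 1
  simp only [Measure.smul_apply, smul_eq_mul]
  rw [Measure.dirac_apply' _ (by measurability), Set.indicator_of_notMem (by simp), mul_zero,
    zero_add]
  refine tsum_congr fun i => ?_
  rw [Measure.dirac_apply' _ (by measurability), Set.indicator_of_mem (by simp),
    Pi.one_apply, mul_one, poissonMeasure_real_singleton_natCast, poissonMass]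
  congr 1
  rw [Nat.factorial_succ (i + 1)]
  push_cast
  have : ((i + 1).factorial : ℝ) ≠ 0 := by positivity
  have e : (i : ℝ) + 1 + 1 = i + 2 := by ring
  have : (i : ℝ) + 2 ≠ 0 := by positivity
  rw [e, one_mul]
  field_simp

theorem hasProd_integral_omega :
    HasProd (fun i : ℕ => ∫ k : ℕ, (2 * omega (i + 2)) ^ k
      ∂(poissonMeasure (1 / (2 * ((i + 2 : ℕ) : ℝ≥0)))))
      (Real.exp (-((1 + Real.log 2) / 2))) := by
  refine hasSum_half_sub_omega.neg.rexp.congr_fun fun i => ?_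
  rw [integral_pow_poissonMeasure, Function.comp]
  congr 1
  push_cast
  have : (i : ℝ) + 2 ≠ 0 := by positivity
  field_simp
  ring

theorem exp_neg_half_mul_exp :
    Real.exp (-1 / 2) * Real.exp (-((1 + Real.log 2) / 2)) = 1 / (Real.exp 1 * √2) := by
  have h2 : √2 = Real.exp (Real.log 2 / 2) := by
    rw [Real.sqrt_eq_rpow, Real.rpow_def_of_pos two_pos]; ring_nf
  rw [h2, ← Real.exp_add, ← Real.exp_add, one_div, ← Real.exp_neg]
  ring_nf

end ScreamingToes

/-! ### The exponential formula over partitions. -/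

namespace ScreamingToes

open Finset Filter Topology PowerSeries

/-- `∏ j, x j ^ a j / (a j)!`, where `a j` is the multiplicity of `j` in `s`. -/
noncomputable def multisetWeight (x : ℕ → ℝ) (s : Multiset ℕ) : ℝ :=
  ∏ j ∈ s.toFinset, x j ^ s.count j / ((s.count j).factorial : ℝ)

theorem multisetWeight_eq_prod (x : ℕ → ℝ) {s : Multiset ℕ} {S : Finset ℕ}
    (h : s.toFinset ⊆ S) :
    multisetWeight x s = ∏ j ∈ S, x j ^ s.count j / ((s.count j).factorial : ℝ) := by
  refine prod_subset h fun j _ hj => ?_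
  rw [Multiset.count_eq_zero.2 (by simpa using hj)]
  simp

theorem multisetWeight_cons (x : ℕ → ℝ) (a : ℕ) (s : Multiset ℕ) :
    ((a ::ₘ s).count a : ℝ) * multisetWeight x (a ::ₘ s) = x a * multisetWeight x s := by
  have h1 : (a ::ₘ s).toFinset ⊆ (a ::ₘ s).toFinset := Subset.rfl
  have h2 : s.toFinset ⊆ (a ::ₘ s).toFinset := by simp
  rw [multisetWeight_eq_prod x h1, multisetWeight_eq_prod x h2]
  have ha : a ∈ (a ::ₘ s).toFinset := by simp
  rw [← mul_prod_erase _ _ ha, ← mul_prod_erase _ _ ha]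
  have e : ∀ j ∈ ((a ::ₘ s).toFinset).erase a,
      x j ^ (a ::ₘ s).count j / (((a ::ₘ s).count j).factorial : ℝ) =
      x j ^ s.count j / ((s.count j).factorial : ℝ) := by
    intro j hj
    rw [Multiset.count_cons_of_ne (ne_of_mem_erase hj)]
  rw [prod_congr rfl e, Multiset.count_cons_self, Nat.factorial_succ, pow_succ]
  push_cast
  have : ((s.count a).factorial : ℝ) ≠ 0 := by positivity
  have : (s.count a : ℝ) + 1 ≠ 0 := by positivity
  field_simp

/-- The sum over the partitions of `n` of `∏ j, x j ^ a j / (a j)!`. -/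
noncomputable def partitionSum (x : ℕ → ℝ) (n : ℕ) : ℝ :=
  ∑ p : n.Partition, multisetWeight x p.parts

theorem parts_toFinset_subset {n : ℕ} (p : n.Partition) : p.parts.toFinset ⊆ Icc 1 n := by
  intro j hj
  rw [Multiset.mem_toFinset] at hj
  exact mem_Icc.2 ⟨p.parts_pos hj, Nat.Partition.le_of_mem_parts hj⟩

theorem sum_mul_count_parts {n : ℕ} (p : n.Partition) :
    ∑ j ∈ Icc 1 n, (j : ℝ) * (p.parts.count j : ℝ) = n := by
  have h : ∑ j ∈ Icc 1 n, p.parts.count j • j = n := by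
    rw [← sum_multiset_count_of_subset p.parts (Icc 1 n) (parts_toFinset_subset p), p.parts_sum]
  calc _ = ((∑ j ∈ Icc 1 n, p.parts.count j • j : ℕ) : ℝ) := by
        push_cast
        exact sum_congr rfl fun j _ => by rw [smul_eq_mul]; push_cast; ring
    _ = n := by rw [h]

/-- Deleting one copy of the part `j` is a bijection onto partitions of `n - j`, and the
multiplicity cancels against the factorial. -/
theorem sum_count_mul_multisetWeight (x : ℕ → ℝ) {n j : ℕ} (hj1 : 1 ≤ j) (hj : j ≤ n) :
    ∑ p : n.Partition, (p.parts.count j : ℝ) * multisetWeight x p.parts =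
      x j * partitionSum x (n - j) := by
  let φ : n.Partition → ℝ := fun p => (p.parts.count j : ℝ) * multisetWeight x p.parts
  have h1 : ∑ p : n.Partition, φ p = ∑ p : {p : n.Partition // j ∈ p.parts}, φ p := by
    rw [← sum_subtype (univ.filter fun p : n.Partition => j ∈ p.parts) (by simp) φ]
    refine (sum_filter_of_ne fun p _ hp => ?_).symm
    by_contra hj
    exact hp (by simp [φ, Multiset.count_eq_zero.2 hj])
  rw [h1, ← (Nat.Partition.partitionWithPartEquiv hj1 hj).symm.sum_comp, partitionSum, mul_sum]
  refine sum_congr rfl fun q _ => ?_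
  simp only [φ, Nat.Partition.partitionWithPartEquiv_symm_apply_parts]
  exact multisetWeight_cons x j q.parts

/-- `g` is the sequence of coefficients of `exp (∑ j ≥ 1, w j / j * X ^ j)`. -/
def IsExpSeq (w g : ℕ → ℝ) : Prop :=
  g 0 = 1 ∧ ∀ n : ℕ, (n : ℝ) * g n = ∑ p ∈ antidiagonal n, w p.1 * g p.2

/-- Write `n = ∑ j a_j` inside the sum over partitions and remove a part `j` from each term. -/
theorem isExpSeq_partitionSum {w : ℕ → ℝ} (hw : w 0 = 0) :
    IsExpSeq w (partitionSum fun j => w j / j) := by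
  constructor
  · simp [partitionSum, multisetWeight]
  intro n
  have h1 : (n : ℝ) * partitionSum (fun j => w j / j) n =
      ∑ j ∈ Icc 1 n, w j * partitionSum (fun j => w j / j) (n - j) := by
    calc _ = ∑ p : n.Partition, ∑ j ∈ Icc 1 n, (j : ℝ) * ((p.parts.count j : ℝ) *
            multisetWeight (fun j => w j / j) p.parts) := by
          rw [partitionSum, mul_sum]
          refine sum_congr rfl fun p _ => ?_
          rw [← sum_mul_count_parts p, sum_mul]
          exact sum_congr rfl fun j _ => by ring
      _ = _ := by
          rw [sum_comm]
          refine sum_congr rfl fun j hj => ?_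
          have hj := mem_Icc.1 hj
          rw [← mul_sum, sum_count_mul_multisetWeight _ hj.1 hj.2]
          have : (j : ℝ) ≠ 0 := by have := hj.1; positivity
          field_simp
  rw [h1, Nat.sum_antidiagonal_eq_sum_range_succ_mk, range_eq_Ico, sum_eq_sum_Ico_succ_bot (by omega), hw]
  simp only [zero_mul, zero_add]
  rfl

theorem coeff_X_mul_derivative (f : ℝ⟦X⟧) (n : ℕ) :
    coeff n (X * d⁄dX ℝ f) = n * coeff n f := by
  cases n with
  | zero => simp
  | succ n => rw [coeff_succ_X_mul, coeff_derivative]; push_cast; ring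

theorem isExpSeq_iff {w g : ℕ → ℝ} :
    IsExpSeq w g ↔ g 0 = 1 ∧ X * d⁄dX ℝ (PowerSeries.mk g) = PowerSeries.mk w * PowerSeries.mk g := by
  refine and_congr_right fun _ => ?_
  rw [PowerSeries.ext_iff]
  refine forall_congr' fun n => ?_
  rw [coeff_X_mul_derivative, coeff_mul]
  simp

theorem IsExpSeq.mul {w g w' g' : ℕ → ℝ} (h : IsExpSeq w g) (h' : IsExpSeq w' g') :
    IsExpSeq (fun n => w n + w' n) fun n => ∑ p ∈ antidiagonal n, g p.1 * g' p.2 := by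
  rw [isExpSeq_iff] at *
  have e : (PowerSeries.mk fun n => ∑ p ∈ antidiagonal n, g p.1 * g' p.2) =
      PowerSeries.mk g * PowerSeries.mk g' := by
    ext n; simp [coeff_mul]
  have e2 : (PowerSeries.mk fun n => w n + w' n) = PowerSeries.mk w + PowerSeries.mk w' := by
    ext n; simp
  refine ⟨by simp [h.1, h'.1], ?_⟩
  rw [e, e2, Derivation.leibniz, smul_eq_mul, smul_eq_mul]
  linear_combination (PowerSeries.mk g') * h.2 + (PowerSeries.mk g) * h'.2

theorem sum_antidiagonal_eq_of_zero {w : ℕ → ℝ} (hw : w 0 = 0) (g : ℕ → ℝ) (n : ℕ) :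
    ∑ p ∈ antidiagonal n, w p.1 * g p.2 = ∑ i ∈ range n, w (i + 1) * g (n - (i + 1)) := by
  rw [Nat.sum_antidiagonal_eq_sum_range_succ_mk, sum_range_succ']
  simp [hw]

theorem IsExpSeq.unique {w g g' : ℕ → ℝ} (hw : w 0 = 0) (h : IsExpSeq w g)
    (h' : IsExpSeq w g') : g = g' := by
  ext n
  induction n using Nat.strong_induction_on with
  | _ n ih =>
    rcases Nat.eq_zero_or_pos n with rfl | hn
    · rw [h.1, h'.1]
    have hn' : (n : ℝ) ≠ 0 := by positivity
    apply mul_left_cancel₀ hn'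
    rw [h.2, h'.2, sum_antidiagonal_eq_of_zero hw, sum_antidiagonal_eq_of_zero hw]
    refine sum_congr rfl fun i hi => ?_
    rw [ih _ (by omega)]

/-- The recurrence for `g' n` has non-negative terms, so domination propagates by strong induction.
-/
theorem IsExpSeq.abs_le {w v g g' : ℕ → ℝ} (hw : w 0 = 0) (hv : v 0 = 0)
    (hwv : ∀ n, |w n| ≤ v n) (h : IsExpSeq w g) (h' : IsExpSeq v g') (n : ℕ) : |g n| ≤ g' n := by
  induction n using Nat.strong_induction_on with
  | _ n ih =>
    rcases Nat.eq_zero_or_pos n with rfl | hn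
    · rw [h.1, h'.1, abs_one]
    have hn' : (0 : ℝ) < n := by exact_mod_cast hn
    refine le_of_mul_le_mul_left ?_ hn'
    rw [← abs_of_pos hn', ← abs_mul, abs_of_pos hn', h.2, h'.2, sum_antidiagonal_eq_of_zero hw,
      sum_antidiagonal_eq_of_zero hv]
    refine (abs_sum_le_sum_abs _ _).trans (sum_le_sum fun i hi => ?_)
    rw [abs_mul]
    have := mem_range.1 hi
    exact mul_le_mul (hwv _) (ih _ (by omega)) (abs_nonneg _) ((abs_nonneg _).trans (hwv _))

theorem hasSum_coeff_pow {f : ℝ⟦X⟧} (hf : ∀ n, 0 ≤ coeff n f) {s : ℝ}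
    (hs : HasSum (fun n => coeff n f) s) (m : ℕ) :
    (∀ n, 0 ≤ coeff n (f ^ m)) ∧ HasSum (fun n => coeff n (f ^ m)) (s ^ m) := by
  induction m with
  | zero =>
    simp only [pow_zero, coeff_one]
    exact ⟨fun n => by split_ifs <;> norm_num, hasSum_ite_eq 0 1⟩
  | succ m ih =>
    have hn : ∀ n, 0 ≤ coeff n (f ^ (m + 1)) := by
      intro n
      rw [pow_succ, coeff_mul]
      exact sum_nonneg fun p _ => mul_nonneg (ih.1 _) (hf _)
    refine ⟨hn, ?_⟩
    have h1 : Summable fun n => ‖coeff n (f ^ m)‖ := ih.2.summable.norm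
    have h2 : Summable fun n => ‖coeff n f‖ := hs.summable.norm
    have h3 := (summable_norm_sum_mul_antidiagonal_of_summable_norm h1 h2).of_norm.hasSum
    rw [← tsum_mul_tsum_eq_tsum_sum_antidiagonal_of_summable_norm h1 h2, ih.2.tsum_eq,
      hs.tsum_eq, ← pow_succ] at h3
    refine h3.congr_fun fun n => ?_
    rw [pow_succ, coeff_mul]

/-- The coefficients of the exponential of a power series with non-negative coefficients. -/
theorem IsExpSeq.hasSum_of_nonneg {v g : ℕ → ℝ} (hv : v 0 = 0) (hv0 : ∀ n, 0 ≤ v n)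
    (h : IsExpSeq v g) {s : ℝ} (hs : HasSum (fun n => v n / n) s) : HasSum g (Real.exp s) := by
  let f : ℝ⟦X⟧ := PowerSeries.mk fun n => v n / n
  have hf : ∀ n, 0 ≤ coeff n f := fun n => by
    simp only [f, coeff_mk]; exact div_nonneg (hv0 n) (Nat.cast_nonneg n)
  have hfs : HasSum (fun n => coeff n f) s := by simpa [f] using hs
  let F : ℕ × ℕ → ℝ := fun p => coeff p.2 (f ^ p.1) / (p.1.factorial : ℝ)
  have hF0 : ∀ p, 0 ≤ F p := fun p =>
    div_nonneg ((hasSum_coeff_pow hf hfs p.1).1 p.2) (Nat.cast_nonneg _)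
  have hrow : ∀ m, HasSum (fun n => F (m, n)) (s ^ m / (m.factorial : ℝ)) := fun m =>
    (hasSum_coeff_pow hf hfs m).2.div_const _
  have hexp : HasSum (fun m : ℕ => s ^ m / (m.factorial : ℝ)) (Real.exp s) := by
    rw [Real.exp_eq_exp_ℝ]
    exact NormedSpace.expSeries_div_hasSum_exp s
  have hF : Summable F := by
    rw [summable_prod_of_nonneg hF0]
    refine ⟨fun m => (hrow m).summable, ?_⟩
    simp only [fun m => (hrow m).tsum_eq]
    exact hexp.summable
  have hcol : ∀ n, Summable fun m => F (m, n) := fun n => hF.prod_symm.prod_factor n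
  have hsum : HasSum (fun n => ∑' m, F (m, n)) (Real.exp s) := by
    have e : Real.exp s = ∑' p, F p := hexp.unique (hF.hasSum.prod_fiberwise hrow)
    have h2 : HasSum (fun p : ℕ × ℕ => F p.swap) (Real.exp s) := by
      rw [e]
      exact (Equiv.prodComm ℕ ℕ).hasSum_iff.2 hF.hasSum
    exact h2.prod_fiberwise fun n => (hcol n).hasSum
  have hXf : X * d⁄dX ℝ f = PowerSeries.mk v := by
    ext n
    rw [coeff_X_mul_derivative, coeff_mk, coeff_mk]
    rcases Nat.eq_zero_or_pos n with rfl | hn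
    · simp [hv]
    · field_simp
  -- The column sums are the coefficients of `∑ f ^ m / m!`; uniqueness identifies them with `g`.
  -- The recurrence follows from `X (f ^ (m+1))' = (m+1) f ^ m · X f'` with `X f' = v`.
  have hE : IsExpSeq v fun n => ∑' m, F (m, n) := by
    constructor
    · have : ∀ m, F (m, 0) = if m = 0 then 1 else 0 := by
        intro m
        have h0 : constantCoeff f = 0 := by simp [f, hv]
        simp only [F, coeff_zero_eq_constantCoeff, map_pow, h0]
        split_ifs with hm
        · simp [hm]
        · simp [hm]
      simp only [this, tsum_ite_eq]
    · intro n
      have hstep : ∀ m, (n : ℝ) * F (m + 1, n) = ∑ p ∈ antidiagonal n, v p.1 * F (m, p.2) := by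
        intro m
        have h1 := coeff_X_mul_derivative (f ^ (m + 1)) n
        rw [Derivation.leibniz_pow, Nat.add_sub_cancel, smul_eq_mul] at h1
        have h2 : X * (m + 1) • (f ^ m * d⁄dX ℝ f) = (m + 1) • (PowerSeries.mk v * f ^ m) := by
          rw [← hXf, mul_smul_comm]; congr 1; ring
        rw [h2, map_nsmul, coeff_mul, nsmul_eq_mul] at h1
        simp only [F]
        rw [mul_div_assoc', ← h1, Nat.factorial_succ]
        push_cast
        simp only [mul_div_assoc', ← sum_div, coeff_mk]
        have : (m.factorial : ℝ) ≠ 0 := by positivity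
        have : (m : ℝ) + 1 ≠ 0 := by positivity
        field_simp
      have h0 : (n : ℝ) * F (0, n) = 0 := by
        simp only [F, pow_zero, coeff_one]
        split_ifs with hn <;> simp [hn]
      have hr : HasSum (fun m => ∑ p ∈ antidiagonal n, v p.1 * F (m, p.2))
          (∑ p ∈ antidiagonal n, v p.1 * ∑' m, F (m, p.2)) :=
        hasSum_sum fun p _ => (hcol p.2).hasSum.mul_left (v p.1)
      have hl : HasSum (fun m => (n : ℝ) * F (m + 1, n)) ((n : ℝ) * ∑' m, F (m, n)) := by
        have := (hasSum_nat_add_iff' 1).2 ((hcol n).hasSum.mul_left (n : ℝ))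
        rwa [sum_range_one, h0, sub_zero] at this
      simp only [hstep] at hl
      exact hl.unique hr
  rw [h.unique hv hE]
  exact hsum

end ScreamingToes

/-! ### Convolution with the coefficients of `(1 - z)^{-1/2}`. -/

namespace ScreamingToes

open Finset Filter Topology

theorem tendsto_sum_antidiagonal_of_summable {h : ℕ → ℝ} (hh : Summable fun k => |h k|)
    {v : ℕ → ℕ → ℝ} {M L : ℝ} (hM : ∀ n m, m ≤ n → |v n m| ≤ M)
    (hL : ∀ k, Tendsto (fun n => v n (n - k)) atTop (𝓝 L)) :
    Tendsto (fun n => ∑ p ∈ antidiagonal n, h p.1 * v n p.2) atTop (𝓝 ((∑' k, h k) * L)) := by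
  have key : Tendsto (fun n => ∑' k, if k ≤ n then h k * v n (n - k) else 0) atTop
      (𝓝 (∑' k, h k * L)) := by
    refine tendsto_tsum_of_dominated_convergence (hh.mul_right M) (fun k => ?_)
      (Eventually.of_forall fun n k => ?_)
    · refine ((hL k).const_mul (h k)).congr' ?_
      filter_upwards [eventually_ge_atTop k] with n hn
      rw [if_pos hn]
    · split_ifs with hk
      · rw [Real.norm_eq_abs, abs_mul]
        exact mul_le_mul_of_nonneg_left (hM n _ (Nat.sub_le n k)) (abs_nonneg _)
      · have := (abs_nonneg _).trans (hM n n le_rfl)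
        rw [norm_zero]; positivity
  rw [tsum_mul_right] at key
  refine key.congr fun n => ?_
  rw [Nat.sum_antidiagonal_eq_sum_range_succ_mk, tsum_eq_sum (s := range (n + 1))]
  · exact sum_congr rfl fun k hk => by rw [if_pos (Nat.lt_succ_iff.1 (mem_range.1 hk))]
  · intro k hk
    rw [if_neg (by simpa using hk)]

/-- The coefficient of `z ^ n` in `(1 - z) ^ (-1/2)`. -/
noncomputable def invSqrtCoeff (n : ℕ) : ℝ :=
  (∏ i ∈ range n, (1 / 2 + (i : ℝ))) / (n.factorial : ℝ)

theorem invSqrtCoeff_pos (n : ℕ) : 0 < invSqrtCoeff n :=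
  div_pos (prod_pos fun i _ => by positivity) (by positivity)

theorem invSqrtCoeff_succ (n : ℕ) :
    ((n : ℝ) + 1) * invSqrtCoeff (n + 1) = (1 / 2 + n) * invSqrtCoeff n := by
  unfold invSqrtCoeff
  rw [prod_range_succ, Nat.factorial_succ]
  push_cast
  have : (n.factorial : ℝ) ≠ 0 := by positivity
  field_simp

theorem invSqrtCoeff_le_one (n : ℕ) : invSqrtCoeff n ≤ 1 := by
  induction n with
  | zero => simp [invSqrtCoeff]
  | succ n ih =>
    have h := invSqrtCoeff_succ n
    have h0 := invSqrtCoeff_pos n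
    have hn : (0 : ℝ) < (n : ℝ) + 1 := by positivity
    nlinarith

/-- The partial sums of the coefficients of `(1 - z) ^ (-1/2)`. -/
noncomputable def invSqrtSum (n : ℕ) : ℝ := ∑ k ∈ range n, invSqrtCoeff k

theorem mul_invSqrtCoeff (n : ℕ) : (n : ℝ) * invSqrtCoeff n = 1 / 2 * invSqrtSum n := by
  induction n with
  | zero => simp [invSqrtSum]
  | succ n ih =>
    have h := invSqrtCoeff_succ n
    rw [invSqrtSum, sum_range_succ, ← invSqrtSum]
    push_cast
    linarith

theorem isExpSeq_invSqrtCoeff : IsExpSeq (fun n => if n = 0 then 0 else 1 / 2) invSqrtCoeff := by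
  refine ⟨by simp [invSqrtCoeff], fun n => ?_⟩
  rw [sum_antidiagonal_eq_of_zero (w := fun n => if n = 0 then (0 : ℝ) else 1 / 2) (by simp), mul_invSqrtCoeff, invSqrtSum, ← sum_range_reflect,
    mul_sum]
  refine sum_congr rfl fun i _ => ?_
  simp only [Nat.add_one_ne_zero, if_false]
  congr 2
  omega

theorem invSqrtSum_mono : Monotone invSqrtSum := fun _ _ h =>
  sum_le_sum_of_subset_of_nonneg (range_mono h) fun i _ _ => (invSqrtCoeff_pos i).le

theorem one_le_invSqrtSum {n : ℕ} (hn : 0 < n) : 1 ≤ invSqrtSum n := by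
  refine le_trans (le_of_eq ?_) (invSqrtSum_mono hn)
  simp [invSqrtSum, invSqrtCoeff]

/-- The relation `n b_n = B_n / 2` with `B_n ≥ 1` bounds the coefficients `b_n` below by a multiple
of `1 / n`, so harmonic divergence suffices. -/
theorem tendsto_invSqrtSum : Tendsto invSqrtSum atTop atTop := by
  have h := Real.tendsto_sum_range_one_div_nat_succ_atTop.const_mul_atTop (r := 1 / 2) (by norm_num)
  refine tendsto_atTop_mono (fun n => ?_) h
  rw [invSqrtSum, mul_sum]
  refine sum_le_sum fun k _ => ?_
  have h1 := invSqrtCoeff_succ k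
  have h2 := mul_invSqrtCoeff (k + 1)
  have h3 := one_le_invSqrtSum (Nat.succ_pos k)
  have h4 := invSqrtCoeff_pos k
  have hk : (0 : ℝ) < (k : ℝ) + 1 := by positivity
  push_cast at h2
  rw [one_div_mul_one_div, div_le_iff₀ (by positivity)]
  nlinarith

theorem tendsto_invSqrtSum_ratio (k : ℕ) :
    Tendsto (fun n => invSqrtSum (n - k) / invSqrtSum n) atTop (𝓝 1) := by
  have h : Tendsto (fun n => 1 - (k : ℝ) / invSqrtSum n) atTop (𝓝 (1 - 0)) :=
    (tendsto_const_nhds.div_atTop tendsto_invSqrtSum).const_sub 1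
  rw [sub_zero] at h
  refine tendsto_of_tendsto_of_tendsto_of_le_of_le' h tendsto_const_nhds ?_ ?_
  · filter_upwards [eventually_ge_atTop (k + 1)] with n hn
    have hB : 0 < invSqrtSum n := one_pos.trans_le (one_le_invSqrtSum (by omega))
    rw [le_div_iff₀ hB, sub_mul, one_mul, div_mul_cancel₀ _ hB.ne']
    obtain ⟨m, rfl⟩ : ∃ m, n = m + k := ⟨n - k, by omega⟩
    have : invSqrtSum (m + k) - invSqrtSum m ≤ k := by
      rw [invSqrtSum, invSqrtSum, sum_range_add, add_sub_cancel_left]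
      calc _ ≤ ∑ i ∈ range k, (1 : ℝ) := sum_le_sum fun i _ => invSqrtCoeff_le_one _
        _ = k := by simp
    rw [Nat.add_sub_cancel]
    linarith
  · filter_upwards [eventually_ge_atTop 1] with n hn
    have hB : 0 < invSqrtSum n := one_pos.trans_le (one_le_invSqrtSum (by omega))
    rw [div_le_one hB]
    exact invSqrtSum_mono (Nat.sub_le n k)

/-- A Cesàro argument: weighted averages of a null sequence, with bounded weights of divergent sum.
-/
theorem tendsto_conv_invSqrtCoeff_div_sum {c : ℕ → ℝ} (hc : Tendsto c atTop (𝓝 0)) :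
    Tendsto (fun n => (∑ p ∈ antidiagonal n, c p.1 * invSqrtCoeff p.2) / invSqrtSum n) atTop
      (𝓝 0) := by
  obtain ⟨M, hM⟩ : ∃ M, ∀ k, |c k| ≤ M := by
    obtain ⟨M, hM⟩ := hc.abs.bddAbove_range
    exact ⟨M, fun k => hM ⟨k, rfl⟩⟩
  have hM0 : 0 ≤ M := (abs_nonneg _).trans (hM 0)
  rw [Metric.tendsto_atTop]
  intro ε hε
  obtain ⟨K, hK⟩ := (Metric.tendsto_atTop.1 hc) (ε / 2) (by positivity)
  -- The term `M * K` pays for the first `K` indices; the extra `ε / 2` pays for the weight at `n`,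
  -- which `invSqrtSum n` leaves out.
  obtain ⟨N, hN⟩ := eventually_atTop.1
    (tendsto_invSqrtSum.eventually_gt_atTop ((ε / 2 + M * K) / (ε / 2)))
  refine ⟨max N 1, fun n hn => ?_⟩
  have hB : 0 < invSqrtSum n :=
    one_pos.trans_le (one_le_invSqrtSum (lt_of_lt_of_le one_pos (le_of_max_le_right hn)))
  have hNn := hN n (le_of_max_le_left hn)
  rw [div_lt_iff₀ (by positivity)] at hNn
  rw [Real.dist_eq, sub_zero, abs_div, abs_of_pos hB, div_lt_iff₀ hB]
  have h1 : |∑ p ∈ antidiagonal n, c p.1 * invSqrtCoeff p.2| ≤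
      ∑ p ∈ antidiagonal n, (ε / 2 * invSqrtCoeff p.2 + if p.1 < K then M else 0) := by
    refine (abs_sum_le_sum_abs _ _).trans (sum_le_sum fun p _ => ?_)
    have hb := invSqrtCoeff_pos p.2
    have hb1 := invSqrtCoeff_le_one p.2
    rw [abs_mul, abs_of_pos hb]
    split_ifs with hp
    · nlinarith [hM p.1, abs_nonneg (c p.1)]
    · have := hK p.1 (not_lt.1 hp)
      rw [Real.dist_eq, sub_zero] at this
      nlinarith
  have h2 : ∑ p ∈ antidiagonal n, ε / 2 * invSqrtCoeff p.2 ≤ ε / 2 * (invSqrtSum n + 1) := by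
    rw [← mul_sum, ← Nat.sum_antidiagonal_swap, Nat.sum_antidiagonal_eq_sum_range_succ_mk]
    simp only [Prod.snd_swap]
    rw [sum_range_succ, ← invSqrtSum]
    have := invSqrtCoeff_le_one n
    gcongr
  have h3 : ∑ p ∈ antidiagonal n, (if p.1 < K then M else 0) ≤ M * K := by
    rw [Nat.sum_antidiagonal_eq_sum_range_succ_mk, ← sum_filter, sum_const, nsmul_eq_mul, mul_comm]
    gcongr
    calc _ ≤ (range K).card := card_le_card fun i hi => by
            simp only [mem_filter] at hi; exact mem_range.2 hi.2
      _ = K := card_range K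
  rw [sum_add_distrib] at h1
  linarith

/-- The ratios `b_{n-k} / b_n` are not uniformly bounded, so dominated convergence is not applied to
them. Multiplying by `n = k + (n - k)` and using `m b_m = B_m / 2` splits the ratio into `2 ∑ (k
h_k) b_{n-k} / B_n`, which vanishes, and `∑ h_k B_{n-k} / B_n`, whose ratios are at most 1 and tend
to 1. -/
theorem tendsto_conv_invSqrtCoeff_div {h : ℕ → ℝ} (hh : Summable fun k => |h k|)
    (h0 : Tendsto (fun k : ℕ => (k : ℝ) * h k) atTop (𝓝 0)) :
    Tendsto (fun n => (∑ p ∈ antidiagonal n, h p.1 * invSqrtCoeff p.2) / invSqrtCoeff n) atTop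
      (𝓝 (∑' k, h k)) := by
  have h1 := (tendsto_conv_invSqrtCoeff_div_sum h0).const_mul 2
  have h2 : Tendsto (fun n => ∑ p ∈ antidiagonal n, h p.1 * (invSqrtSum p.2 / invSqrtSum n)) atTop
      (𝓝 ((∑' k, h k) * 1)) := by
    refine tendsto_sum_antidiagonal_of_summable (v := fun n m => invSqrtSum m / invSqrtSum n)
      (M := 1) hh (fun n m hm => ?_) tendsto_invSqrtSum_ratio
    have hp : ∀ n, 0 ≤ invSqrtSum n := fun n => sum_nonneg fun i _ => (invSqrtCoeff_pos i).le
    rw [abs_of_nonneg (div_nonneg (hp _) (hp _))]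
    exact div_le_one_of_le₀ (invSqrtSum_mono hm) (hp _)
  have h3 := h1.add h2
  rw [mul_zero, zero_add, mul_one] at h3
  refine h3.congr' ?_
  filter_upwards [eventually_gt_atTop 0] with n hn
  have hn' : (n : ℝ) ≠ 0 := by positivity
  have hB : invSqrtSum n ≠ 0 := (one_pos.trans_le (one_le_invSqrtSum hn)).ne'
  have hb : invSqrtCoeff n ≠ 0 := (invSqrtCoeff_pos n).ne'
  have hBb : invSqrtSum n = 2 * (n * invSqrtCoeff n) := by rw [mul_invSqrtCoeff]; ring
  rw [eq_div_iff hb, add_mul, mul_assoc, div_mul_eq_mul_div, sum_mul, sum_mul, sum_div, mul_sum,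
    ← sum_add_distrib]
  refine sum_congr rfl fun p hp => ?_
  have hpn : (p.1 : ℝ) + p.2 = n := by exact_mod_cast mem_antidiagonal.1 hp
  have hm := mul_invSqrtCoeff p.2
  have hBm : invSqrtSum p.2 = 2 * (p.2 * invSqrtCoeff p.2) := by rw [mul_invSqrtCoeff]; ring
  rw [hBb, hBm]
  field_simp
  rw [hpn]

/-! ### The limit of the acceptance rate. -/

/-- The exponents of the defect `∑ j, d j / j * z ^ j` separating the generating function of the
acceptance rate from `(1 - z) ^ (-1/2)`. -/
noncomputable def defect (j : ℕ) : ℝ :=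
  if j = 0 then 0 else if j = 1 then 1 / 2 else 1 / 2 - omega j

theorem defect_nonneg (j : ℕ) : 0 ≤ defect j := by
  unfold defect
  split_ifs with h0 h1
  · exact le_rfl
  · norm_num
  · obtain ⟨m, rfl⟩ : ∃ m, j = m + 1 := ⟨j - 1, by omega⟩
    exact sub_nonneg.2 (omega_succ_le_half m)

theorem tendsto_defect : Tendsto defect atTop (𝓝 0) := by
  refine tendsto_half_sub_omega.congr' ?_
  filter_upwards [eventually_gt_atTop 1] with n hn
  rw [defect, if_neg (by omega), if_neg (by omega)]

theorem hasSum_defect_div :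
    HasSum (fun j : ℕ => defect j / j) (1 / 2 + (1 + Real.log 2) / 2) := by
  rw [← hasSum_nat_add_iff' 2]
  have e : 1 / 2 + (1 + Real.log 2) / 2 - ∑ i ∈ range 2, defect i / (i : ℝ) =
      (1 + Real.log 2) / 2 := by
    simp [sum_range_succ, defect]
  rw [e]
  refine hasSum_half_sub_omega.congr_fun fun i => ?_
  rw [defect, if_neg (by omega), if_neg (by omega)]
  ring

theorem tendsto_partitionSum_div_invSqrtCoeff :
    Tendsto (fun n => partitionSum (fun j => ((if j = 0 then 0 else 1 / 2) - defect j) / j) n /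
      invSqrtCoeff n) atTop (𝓝 (1 / (Real.exp 1 * √2))) := by
  have hd0 : defect 0 = 0 := by simp [defect]
  obtain ⟨h, hh⟩ : ∃ h, IsExpSeq (fun j => -defect j) h :=
    ⟨_, isExpSeq_partitionSum (by simp [hd0])⟩
  obtain ⟨k, hk⟩ : ∃ k, IsExpSeq defect k := ⟨_, isExpSeq_partitionSum hd0⟩
  have hks := hk.hasSum_of_nonneg hd0 defect_nonneg hasSum_defect_div
  have hhk : ∀ n, |h n| ≤ k n := hh.abs_le (by simp [hd0]) hd0
    (fun n => by rw [abs_neg, abs_of_nonneg (defect_nonneg n)]) hk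
  have hhs : Summable fun n => |h n| := Summable.of_nonneg_of_le (fun n => abs_nonneg _) hhk hks.summable
  -- As `h` is signed, its sum is found as the inverse of the sum of `k`: the two exponentials have
  -- product 1.
  have hsum : ∑' n, h n = 1 / (Real.exp 1 * √2) := by
    have h1 : (fun n => ∑ p ∈ antidiagonal n, h p.1 * k p.2) = fun n => if n = 0 then 1 else 0 := by
      refine (hh.mul hk).unique (by simp) ⟨by simp, fun n => ?_⟩
      simp
    have hhn : Summable fun n => ‖h n‖ := hhs
    have hkn : Summable fun n => ‖k n‖ := hks.summable.norm
    have h2 := tsum_mul_tsum_eq_tsum_sum_antidiagonal_of_summable_norm hhn hkn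
    rw [h1, tsum_ite_eq, hks.tsum_eq] at h2
    rw [← exp_neg_half_mul_exp, ← Real.exp_add, eq_div_of_mul_eq (Real.exp_pos _).ne' h2,
      one_div, ← Real.exp_neg]
    ring_nf
  -- By its recurrence, `n * h n` is the convolution of the summable `h` with the null sequence
  -- `-defect`.
  have hlim : Tendsto (fun n : ℕ => (n : ℝ) * h n) atTop (𝓝 0) := by
    obtain ⟨M, hM⟩ := tendsto_defect.bddAbove_range
    have h1 := tendsto_sum_antidiagonal_of_summable (v := fun _ m => -defect m) (M := M) (L := 0)
      hhs (fun n m _ => by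
        rw [abs_neg, abs_of_nonneg (defect_nonneg m)]; exact hM ⟨m, rfl⟩)
      (fun k => by
        rw [← neg_zero]
        exact (tendsto_defect.comp (tendsto_sub_atTop_nat k)).neg)
    rw [mul_zero] at h1
    refine h1.congr fun n => ?_
    rw [hh.2 n, ← Nat.sum_antidiagonal_swap]
    exact sum_congr rfl fun p _ => by simp [mul_comm]
  have hg := isExpSeq_partitionSum (w := fun j => (if j = 0 then 0 else 1 / 2) - defect j)
    (by simp [hd0])
  have hconv := (hh.mul isExpSeq_invSqrtCoeff)
  have e : (fun n => -defect n + if n = 0 then 0 else 1 / 2) =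
      fun j => (if j = 0 then 0 else 1 / 2) - defect j := by
    ext n; ring
  rw [e] at hconv
  rw [hg.unique (by simp [hd0]) hconv, ← hsum]
  exact tendsto_conv_invSqrtCoeff_div hhs hlim

/-- The weight at `j ≥ 2` is `(1 / (2j)) (2 omega j) = omega j / j`; at `j = 1` it is 0, and `0 ^
a_1` reproduces the indicator of `a_1 = 0`. -/
theorem acceptanceRate_eq {n : ℕ} (hn : 0 < n) :
    acceptanceRate n = partitionSum (fun j => ((if j = 0 then 0 else 1 / 2) - defect j) / j) n /
      invSqrtCoeff n := by
  rw [acceptanceRate, partitionSum, sum_div]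
  refine sum_congr rfl fun p _ => ?_
  rw [multisetWeight_eq_prod _ (parts_toFinset_subset p), ewens, acceptWeight, invSqrtCoeff]
  have hI : Icc 1 n = insert 1 (Icc 2 n) := by
    ext j; simp only [mem_Icc, mem_insert]; omega
  have hI1 : 1 ∉ Icc 2 n := by simp
  rw [hI, prod_insert hI1, prod_insert hI1]
  have hP : ∏ i ∈ range n, (1 / 2 + (i : ℝ)) ≠ 0 := prod_ne_zero_iff.2 fun i _ => by positivity
  have hd1 : ((if 1 = 0 then 0 else 1 / 2) - defect 1) / ((1 : ℕ) : ℝ) = 0 := by simp [defect]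
  rw [hd1]
  split_ifs with h1
  · rw [h1]
    have e : ∏ j ∈ Icc 2 n, (((if j = 0 then 0 else 1 / 2) - defect j) / (j : ℝ)) ^
          p.parts.count j / ((p.parts.count j).factorial : ℝ) =
        (∏ j ∈ Icc 2 n, (1 / 2 / (j : ℝ)) ^ p.parts.count j /
          ((p.parts.count j).factorial : ℝ)) *
        ∏ j ∈ Icc 2 n, (omega j / (1 / 2)) ^ p.parts.count j := by
      rw [← prod_mul_distrib]
      refine prod_congr rfl fun j hj => ?_
      have hj := (mem_Icc.1 hj).1
      rw [defect, if_neg (by omega), if_neg (by omega), if_neg (by omega), div_mul_eq_mul_div,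
        ← mul_pow]
      congr 2
      ring
    rw [e, div_div_eq_mul_div]
    simp only [pow_zero, Nat.factorial_zero, Nat.cast_one, div_one, one_mul]
    ring
  · rw [zero_pow h1]
    simp

end ScreamingToes

theorem mainTheorem7 :
    -- the series of the screaming toes mapping, summed over `j = i + 2 ≥ 2`
    HasSum (fun i : ℕ => 1 / ((i + 2 : ℕ) : ℝ) * (1 / 2 - ScreamingToes.omega (i + 2)))
      ((1 + Real.log 2) / 2) ∧
    -- the series of the standard mapping, summed over `j = i + 1 ≥ 1`
    HasSum (fun i : ℕ => 1 / ((i + 1 : ℕ) : ℝ) *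
        (1 / 2 - (ProbabilityTheory.poissonMeasure ((i + 1 : ℕ) : ℝ≥0)).real (Set.Iio (i + 1))))
      (Real.log 2 / 2) ∧
    -- the tail of the Borel distribution, summed over `j = i + 2 ≥ 2`
    HasSum (fun i : ℕ => 1 / ((i + 2 : ℕ) : ℝ) *
        (ProbabilityTheory.poissonMeasure ((i + 2 : ℕ) : ℝ≥0)).real {i + 1})
      ((ScreamingToes.borelMeasure 1).real (Set.Ici 2)) ∧
    (ScreamingToes.borelMeasure 1).real (Set.Ici 2) = 1 - 1 / Real.exp 1 ∧
    -- the infinite product over `j = i + 2 ≥ 2`, with `Z_j` Poisson of mean `1 / (2 j)`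
    (Multipliable (fun i : ℕ =>
        ∫ k : ℕ, (2 * ScreamingToes.omega (i + 2)) ^ k
          ∂(ProbabilityTheory.poissonMeasure (1 / (2 * ((i + 2 : ℕ) : ℝ≥0))))) ∧
      Real.exp (-1 / 2) *
        (∏' i : ℕ, ∫ k : ℕ, (2 * ScreamingToes.omega (i + 2)) ^ k
          ∂(ProbabilityTheory.poissonMeasure (1 / (2 * ((i + 2 : ℕ) : ℝ≥0))))) =
        1 / (Real.exp 1 * Real.sqrt 2)) ∧
    -- the limit of the acceptance rate
    Filter.Tendsto ScreamingToes.acceptanceRate Filter.atTop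
      (nhds (1 / (Real.exp 1 * Real.sqrt 2))) := by
  refine ⟨ScreamingToes.hasSum_half_sub_omega, ScreamingToes.hasSum_half_sub_poissonMeasure, ?_,
    ScreamingToes.borelMeasure_one_real_Ici_two,
    ⟨ScreamingToes.hasProd_integral_omega.multipliable, ?_⟩, ?_⟩
  · rw [ScreamingToes.borelMeasure_one_real_Ici_two]
    exact ScreamingToes.hasSum_poissonMeasure_singleton
  · rw [ScreamingToes.hasProd_integral_omega.tprod_eq]
    exact ScreamingToes.exp_neg_half_mul_exp
  · refine ScreamingToes.tendsto_partitionSum_div_invSqrtCoeff.congr' ?_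
    filter_upwards [Filter.eventually_gt_atTop 0] with n hn
    exact (ScreamingToes.acceptanceRate_eq hn).symm
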